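/- **Conventions.** A complex random variable $f$ on a probability space $(\Omega,\mathcal A,\mathbb P)$ is subgaussian if there is $s\ge 0$ with $\mathbb E\exp(\mathrm{Re}(zf))\le \exp(s^2|z|^2/2)$ for all $z\in\mathbb C$; the least such $s$ is denoted $\mathrm{sg}(f)$. (A real random variable is regarded as a complex one; the condition then amounts to $\mathbb E\exp(xf)\le \exp(s^2x^2/2)$ for all $x\in\mathbb R$.) For $1\le r<\infty$ let $\varphi_r(t)=e^{t^r}-1$ and $$\|f\|_{L_{\varphi_r}}=\inf\Big\{\varepsilon>0:\ \int_\Omega \varphi_r\big(|f|/\varepsilon\big)\,d\mathbb P\le 1\Big\}.$$ For $a\in\mathbb C^K$ with decreasing rearrangement $a_1^*\ge\dots\ge a_K^*$ of $(|a_1|,\dots,|a_K|)$ let $\|a\|_{\ell_2}=(\sum_i|a_i|^2)^{1/2}$ and, for $1<p<\infty$, $\|a\|_{\ell_{p,\infty}}=\max_{1\le k\le K}k^{1/p}a_k^*$. For a complex Banach space $X$ with closed unit ball $B_X$, $\mathcal P_m(X)$ is the set of all $P=\sum_{k=0}^m P_k$, where $P_k(z)=L_k(z,\dots,z)$ for a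 bounded $k$-linear form $L_k$ on $X^k$ ($P_0$ a constant). Put $\log^+ m=\log m$ for $m\ge 1$ and $\log^+ 0=0$. **Theorem.** (1) For every $s\ge 0$ there is a constant $C_2=C(s)>0$ such that for every sequence $\gamma_1,\dots,\gamma_K$ of independent (real or complex) subgaussian random variables on a probability space with $\mathrm{sg}(\gamma_i)\le s$ for all $i$, every $m\in\mathbb N_0$, every $n\in\mathbb N=\{1,2,\dots\}$, every complex $n$-dimensional Banach space $X$, and all $P_1,\dots,P_K\in\mathcal P_m(X)$, $$\Big\|\sup_{z\in B_X}\Big|\sum_{i=1}^K\gamma_iP_i(z)\Big|\Big\|_{L_{\varphi_2}}\le C_2\,\big(n(1+\log^+ m)\big)^{1/2}\sup_{z\in B_X}\big\|(P_i(z))_{i=1}^K\big\|_{\ell_2}.$$ (2) For every $r\in(2,\infty)$, with $1/r+1/r'=1$, and all $s,M\ge 0$ there is a constant $C_r=C(r,s,M)>0$ such that for every sequence $\gamma_1,\dots,\gamma_K$ of independent (real or complex) subgaussian random variables on a probability space with $\mathrm{sg}(\gamma_i)\le s$ and $\|\gamma_i\|_\infty\le M$ for all $i$, every $m\in\mathbb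 N_0$, every $n\in\mathbb N$, every complex $n$-dimensional Banach space $X$, and all $P_1,\dots,P_K\in\mathcal P_m(X)$, $$\Big\|\sup_{z\in B_X}\Big|\sum_{i=1}^K\gamma_iP_i(z)\Big|\Big\|_{L_{\varphi_r}}\le C_r\,\big(n(1+\log^+ m)\big)^{1/r}\sup_{z\in B_X}\big\|(P_i(z))_{i=1}^K\big\|_{\ell_{r',\infty}}.$$ -/

import Mathlib

open MeasureTheory ProbabilityTheory
open scoped ENNReal NNReal

namespace KSZ

/-- `E exp (Re (z f)) ≤ exp (s² |z|² / 2)` for every complex `z`. The expectation is taken in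
`[0, ∞]`, so its finiteness is part of the condition. For a real-valued `f` this is the usual real
condition, see `hasSubgaussianBound_ofReal_iff`. -/
def HasSubgaussianBound {Ω : Type*} [MeasurableSpace Ω] (f : Ω → ℂ) (s : ℝ) (μ : Measure Ω) :
    Prop :=
  ∀ z : ℂ, ∫⁻ ω, ENNReal.ofReal (Real.exp (z * f ω).re) ∂μ
    ≤ ENNReal.ofReal (Real.exp (s ^ 2 * ‖z‖ ^ 2 / 2))

/-- A (real or complex) subgaussian random variable. -/
def IsSubgaussian {Ω : Type*} [MeasurableSpace Ω] (f : Ω → ℂ) (μ : Measure Ω) : Prop :=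
  Measurable f ∧ ∃ s : ℝ, 0 ≤ s ∧ HasSubgaussianBound f s μ

/-- The subgaussian constant `sg(f)`: the best `s ≥ 0` in the subgaussian condition. -/
noncomputable def sg {Ω : Type*} [MeasurableSpace Ω] (f : Ω → ℂ) (μ : Measure Ω) : ℝ :=
  sInf {s : ℝ | 0 ≤ s ∧ HasSubgaussianBound f s μ}

/-- For real-valued variables, the complex subgaussian condition with parameter `s` is the real
subgaussian condition with the same parameter. -/
theorem hasSubgaussianBound_ofReal_iff {Ω : Type*} [MeasurableSpace Ω] (g : Ω → ℝ) (s : ℝ)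
    (μ : Measure Ω) :
    HasSubgaussianBound (fun ω => (g ω : ℂ)) s μ ↔
      ∀ x : ℝ, ∫⁻ ω, ENNReal.ofReal (Real.exp (x * g ω)) ∂μ
        ≤ ENNReal.ofReal (Real.exp (s ^ 2 * x ^ 2 / 2)) := by
  constructor
  · intro h x
    have := h (x : ℂ)
    simpa using this
  · intro h z
    have h1 := h z.re
    have h2 : z.re ^ 2 ≤ ‖z‖ ^ 2 := by
      rw [← sq_abs z.re]
      exact pow_le_pow_left₀ (abs_nonneg _) (Complex.abs_re_le_norm z) 2
    have h3 : Real.exp (s ^ 2 * z.re ^ 2 / 2) ≤ Real.exp (s ^ 2 * ‖z‖ ^ 2 / 2) := by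
      gcongr
    refine le_trans ?_ (h1.trans (ENNReal.ofReal_le_ofReal h3))
    simp

/-- The exponential Orlicz function `φ_r(t) = exp (t ^ r) - 1`, for `t ≥ 0`. -/
noncomputable def expOrlicz (r t : ℝ) : ℝ := Real.exp (t ^ r) - 1

/-- The Orlicz norm `‖f‖_{L_{φ_r}} = inf {ε > 0 : ∫ φ_r(|f| / ε) dμ ≤ 1}`, with values in `[0, ∞]`
(it is `∞` if there is no such `ε`). -/
noncomputable def orliczNorm {Ω : Type*} [MeasurableSpace Ω] (r : ℝ) (f : Ω → ℝ) (μ : Measure Ω) :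
    ℝ≥0∞ :=
  ⨅ (ε : ℝ≥0) (_ : 0 < ε ∧ ∫⁻ ω, ENNReal.ofReal (expOrlicz r (|f ω| / ε)) ∂μ ≤ 1), (ε : ℝ≥0∞)

/-- `P` is a polynomial of degree at most `m` on `X`: a sum `P_0 + ⋯ + P_m`, where each `P_k` is
the restriction to the diagonal of a bounded `k`-linear form on `X ^ k`. -/
def IsPolynomialOfDegreeLE {X : Type*} [NormedAddCommGroup X] [NormedSpace ℂ X] (m : ℕ)
    (P : X → ℂ) : Prop :=
  ∃ L : (k : ℕ) → ContinuousMultilinearMap ℂ (fun _ : Fin k => X) ℂ,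
    ∀ z : X, P z = ∑ k ∈ Finset.range (m + 1), L k (fun _ => z)

/-- The norm of `ℓ_2` on `ℂ ^ K`. -/
noncomputable def l2Norm {K : ℕ} (a : Fin K → ℂ) : ℝ := Real.sqrt (∑ i, ‖a i‖ ^ 2)

/-- The decreasing rearrangement of `(|a_1|, …, |a_K|)`. -/
noncomputable def decRearr {K : ℕ} (a : Fin K → ℂ) (k : Fin K) : ℝ :=
  ‖a (Tuple.sort (fun i => -‖a i‖) k)‖

/-- The Marcinkiewicz (weak `ℓ_p`) functional on `ℂ ^ K`, `max_{1 ≤ k ≤ K} k ^ (1 / p) * a_k^*`,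
where `a^*` is the decreasing rearrangement (indexed from `0` in the code). -/
noncomputable def weakNorm {K : ℕ} (p : ℝ) (a : Fin K → ℂ) : ℝ :=
  ⨆ k : Fin K, ((k : ℝ) + 1) ^ (1 / p) * decRearr a k

/-- The decreasing rearrangement is decreasing. -/
theorem decRearr_antitone {K : ℕ} (a : Fin K → ℂ) : Antitone (decRearr a) := by
  intro i j hij
  have := Tuple.monotone_sort (fun i => -‖a i‖) hij
  simpa [decRearr] using this

end KSZ

/-! The supremum is replaced by a maximum over a finite set, and a logarithm of the size of that set
is paid for the maximum. A polynomial of degree at most `m` bounded by `S` on the unit ball is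
Lipschitz with constant about `m * S` near that ball, so on a net of mesh about `1 / m` it attains
half of its supremum. By a volume count in real dimension `2n` such a net has at most `(17 max(m,1))
^ (2n)` points, whose logarithm is of order `n(1 + log⁺ m)` (`exists_norming_finset`).

At one point `w` of the net, with `a = (P_i(w))` and `W` a bound for the relevant norm of `a`, the
sum `∑ γ_i a_i` exceeds `B k^{1/r}` with probability at most `4 exp(-ck)`, where `B` is a constant
times `W`. For `r = 2` this is the subgaussian tail. For `r > 2` the decreasing rearrangement of `a`
is cut at `k`: the first `k` terms contribute at most a multiple of `M W k^{1/r}` almost surely,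
while the others have square sum of order `W² k^{2/r-1}`, so their subgaussian tail at level `W
k^{1/r}` is again exponential in `k` (`measure_norm_sum_ge_le_of_weakNorm`).

These tails give a uniform exponential moment of the `r`-th power at each net point, and Jensen's
inequality turns it into the Orlicz bound for the maximum, with the factor `(log card)^{1/r}`
(`orliczNorm_le_of_forall_exists_le`). -/

namespace KSZ

/-! ### Growth and Lipschitz estimates for polynomials near the unit ball -/

section Polynomials

variable {X : Type*} [NormedAddCommGroup X] [NormedSpace ℂ X]

theorem IsPolynomialOfDegreeLE.differentiable {m : ℕ} {P : X → ℂ}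
    (hP : IsPolynomialOfDegreeLE m P) : Differentiable ℂ P := by
  obtain ⟨L, hL⟩ := hP
  rw [funext hL]
  refine Differentiable.fun_sum fun k _ => ?_
  have h : ContDiff ℂ 1 (L k) := (L k).contDiff
  exact (h.differentiable one_ne_zero).comp (differentiable_pi.2 fun _ => differentiable_id)

theorem IsPolynomialOfDegreeLE.sum_mul {ι : Type*} (s : Finset ι) {m : ℕ} {P : ι → X → ℂ}
    (hP : ∀ i, IsPolynomialOfDegreeLE m (P i)) (c : ι → ℂ) :
    IsPolynomialOfDegreeLE m (fun z => ∑ i ∈ s, c i * P i z) := by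
  choose L hL using hP
  refine ⟨fun k => ∑ i ∈ s, c i • L i k, fun z => ?_⟩
  simp only [hL, Finset.mul_sum, sum_apply, smul_apply, smul_eq_mul]
  exact Finset.sum_comm

/-- Maximum principle for the reversed one-variable polynomial `Q(l) = l ^ m * P(l⁻¹ u)`, with `u =
z / R`: it is bounded by `M` on the unit circle, hence at `l = 1 / R`, where `P z = R ^ m * Q(1 /
R)`. -/
theorem IsPolynomialOfDegreeLE.norm_le_pow_mul {m : ℕ} {P : X → ℂ}
    (hP : IsPolynomialOfDegreeLE m P) {M R : ℝ} (hM : ∀ z ∈ Metric.closedBall (0 : X) 1, ‖P z‖ ≤ M)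
    (hR : 1 ≤ R) {z : X} (hz : ‖z‖ ≤ R) : ‖P z‖ ≤ R ^ m * M := by
  obtain ⟨L, hL⟩ := hP
  have hR0 : (0 : ℝ) < R := by linarith
  have hRC : (R : ℂ) ≠ 0 := by exact_mod_cast hR0.ne'
  obtain ⟨u, hu⟩ : ∃ u : X, u = ((R : ℂ)⁻¹) • z := ⟨_, rfl⟩
  have hu1 : ‖u‖ ≤ 1 := by
    rw [hu, norm_smul, norm_inv, Complex.norm_real, Real.norm_of_nonneg hR0.le]
    rwa [inv_mul_le_iff₀ hR0, mul_one]
  have hsmul : ∀ (l : ℂ) (v : X) (k : ℕ), L k (fun _ => l • v) = l ^ k * L k (fun _ => v) := by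
    intro l v k
    have := (L k).map_smul_univ (fun _ => l) (fun _ => v)
    simpa using this
  have hrev : ∀ l : ℂ, l ≠ 0 →
      P (l⁻¹ • u) = l⁻¹ ^ m * ∑ k ∈ Finset.range (m + 1), l ^ (m - k) * L k (fun _ => u) := by
    intro l hl
    rw [hL, Finset.mul_sum]
    refine Finset.sum_congr rfl fun k hk => ?_
    have hk' : k ≤ m := by simpa [Nat.lt_succ_iff] using hk
    rw [hsmul, ← mul_assoc]
    congr 1
    obtain ⟨j, rfl⟩ := Nat.exists_eq_add_of_le hk'
    rw [Nat.add_sub_cancel_left, pow_add, mul_assoc, ← mul_pow, inv_mul_cancel₀ hl, one_pow,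
      mul_one]
  have hdisc : ∀ l ∈ closure (Metric.ball (0 : ℂ) 1),
      ‖∑ k ∈ Finset.range (m + 1), l ^ (m - k) * L k (fun _ => u)‖ ≤ M := by
    intro l hl
    refine Complex.norm_le_of_forall_mem_frontier_norm_le (f := fun l : ℂ =>
      ∑ k ∈ Finset.range (m + 1), l ^ (m - k) * L k (fun _ => u)) Metric.isBounded_ball
      (Differentiable.diffContOnCl (by fun_prop)) ?_ hl
    intro l hl
    rw [frontier_ball _ one_ne_zero] at hl
    have hl1 : ‖l‖ = 1 := by simpa using hl
    have hl0 : l ≠ 0 := norm_ne_zero_iff.1 (by rw [hl1]; exact one_ne_zero)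
    have h1 := hM (l⁻¹ • u) (by
      rw [mem_closedBall_zero_iff, norm_smul, norm_inv, hl1]; simpa using hu1)
    rw [hrev l hl0, norm_mul, norm_pow, norm_inv, hl1] at h1
    simpa using h1
  have hinv : (R : ℂ)⁻¹ ∈ closure (Metric.ball (0 : ℂ) 1) := by
    rw [closure_ball _ one_ne_zero, mem_closedBall_zero_iff, norm_inv, Complex.norm_real,
      Real.norm_of_nonneg hR0.le]
    exact inv_le_one_of_one_le₀ hR
  have h2 := hrev ((R : ℂ)⁻¹) (inv_ne_zero hRC)
  rw [inv_inv, hu, smul_smul, mul_inv_cancel₀ hRC, one_smul] at h2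
  rw [h2, norm_mul, norm_pow, Complex.norm_real, Real.norm_of_nonneg hR0.le, ← hu]
  exact mul_le_mul_of_nonneg_left (hdisc _ hinv) (by positivity)

theorem one_add_inv_pow_le_three (m : ℕ) : (1 + 1 / ((max m 1 : ℕ) : ℝ)) ^ m ≤ 3 := by
  have hN : (0 : ℝ) < ((max m 1 : ℕ) : ℝ) := by positivity
  have hm : (m : ℝ) ≤ ((max m 1 : ℕ) : ℝ) := by exact_mod_cast le_max_left _ _
  calc (1 + 1 / ((max m 1 : ℕ) : ℝ)) ^ m
      ≤ (Real.exp (1 / ((max m 1 : ℕ) : ℝ))) ^ m := by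
        gcongr
        linarith [Real.add_one_le_exp (1 / ((max m 1 : ℕ) : ℝ))]
    _ = Real.exp (m * (1 / ((max m 1 : ℕ) : ℝ))) := (Real.exp_nat_mul _ _).symm
    _ ≤ Real.exp 1 := by
        gcongr
        rw [mul_one_div]
        exact (div_le_one hN).2 hm
    _ ≤ 3 := by linarith [Real.exp_one_lt_d9]

/-- A Bernstein-type estimate from the Schwarz lemma. On the ball of radius `1 / max m 1` about `z`
growth costs at most `(1 + 1/m) ^ m ≤ e ≤ 3`, so `P` stays within `3M + M` of `P z`. The `max`
covers degree `0` and matches `log⁺ 0 = 0`. -/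
theorem IsPolynomialOfDegreeLE.norm_sub_le {m : ℕ} {P : X → ℂ}
    (hP : IsPolynomialOfDegreeLE m P) {M : ℝ} (hM : ∀ z ∈ Metric.closedBall (0 : X) 1, ‖P z‖ ≤ M)
    {z w : X} (hz : ‖z‖ ≤ 1) (hw : ‖w - z‖ < 1 / ((max m 1 : ℕ) : ℝ)) :
    ‖P w - P z‖ ≤ 4 * ((max m 1 : ℕ) : ℝ) * M * ‖w - z‖ := by
  have hN : (0 : ℝ) < ((max m 1 : ℕ) : ℝ) := by positivity
  have hM0 : 0 ≤ M := (norm_nonneg _).trans (hM 0 (by simp))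
  have hmaps : Set.MapsTo P (Metric.ball z (1 / ((max m 1 : ℕ) : ℝ)))
      (Metric.closedBall (P z) (4 * M)) := by
    intro y hy
    rw [mem_ball_iff_norm] at hy
    have hy' : ‖y‖ ≤ 1 + 1 / ((max m 1 : ℕ) : ℝ) := by
      have := norm_le_norm_add_norm_sub' y z
      linarith
    have h1 := hP.norm_le_pow_mul hM (by simp) hy'
    have h2 := mul_le_mul_of_nonneg_right (one_add_inv_pow_le_three m) hM0
    have h3 := hM z (by simpa using hz)
    rw [mem_closedBall_iff_norm]
    have := _root_.norm_sub_le (P y) (P z)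
    linarith
  have h := Complex.dist_le_div_mul_dist_of_mapsTo_ball (z := w)
    hP.differentiable.differentiableOn hmaps (by rwa [mem_ball_iff_norm])
  rw [dist_eq_norm, dist_eq_norm] at h
  refine h.trans_eq ?_
  field_simp

end Polynomials

/-! ### Volumetric bound for nets of the unit ball -/

section Covering

/-- The balls of radius `δ / 2` about the points are disjoint and lie in the ball of radius `1 + δ /
2`; compare Haar measures. -/
theorem card_le_of_separated_closedBall {E : Type*} [NormedAddCommGroup E] [NormedSpace ℝ E]
    [FiniteDimensional ℝ E] (s : Finset E) {δ : ℝ} (hδ : 0 < δ) (hs : ∀ c ∈ s, ‖c‖ ≤ 1)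
    (h : ∀ c ∈ s, ∀ d ∈ s, c ≠ d → δ ≤ ‖c - d‖) :
    (s.card : ℝ) ≤ (1 + 2 / δ) ^ Module.finrank ℝ E := by
  borelize E
  let μ : Measure E := Measure.addHaar
  have hδ2 : 0 < δ / 2 := by positivity
  have hρ : 0 < 1 + δ / 2 := by positivity
  have D : Set.Pairwise (s : Set E) (Function.onFun Disjoint fun c =>
      Metric.ball (c : E) (δ / 2)) := by
    rintro c hc d hd hcd
    apply Metric.ball_disjoint_ball
    rw [dist_eq_norm]
    linarith [h c hc d hd hcd]
  have hsub : (⋃ c ∈ s, Metric.ball (c : E) (δ / 2)) ⊆ Metric.ball (0 : E) (1 + δ / 2) := by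
    refine Set.iUnion₂_subset fun x hx => Metric.ball_subset_ball' ?_
    rw [dist_zero_right]
    linarith [hs x hx]
  have I : (s.card : ℝ≥0∞) * ENNReal.ofReal ((δ / 2) ^ Module.finrank ℝ E) * μ (Metric.ball 0 1) ≤
      ENNReal.ofReal ((1 + δ / 2) ^ Module.finrank ℝ E) * μ (Metric.ball 0 1) :=
    calc
      _ = μ (⋃ c ∈ s, Metric.ball (c : E) (δ / 2)) := by
        rw [measure_biUnion_finset D fun c _ => measurableSet_ball]
        simp only [μ.addHaar_ball_of_pos _ hδ2]
        simp only [Finset.sum_const, nsmul_eq_mul, mul_assoc]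
      _ ≤ μ (Metric.ball (0 : E) (1 + δ / 2)) := measure_mono hsub
      _ = _ := by simp only [μ.addHaar_ball_of_pos _ hρ]
  have J := (ENNReal.mul_le_mul_iff_left (Metric.measure_ball_pos _ _ zero_lt_one).ne'
    measure_ball_lt_top.ne).1 I
  have K := ENNReal.toReal_le_of_le_ofReal (pow_nonneg hρ.le _) J
  rw [ENNReal.toReal_mul, ENNReal.toReal_natCast, ENNReal.toReal_ofReal (by positivity)] at K
  have h2 : (1 + 2 / δ) = (1 + δ / 2) / (δ / 2) := by field_simp; ring
  rw [h2, div_pow, le_div_iff₀ (by positivity)]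
  exact K

theorem exists_finset_net {E : Type*} [NormedAddCommGroup E] [NormedSpace ℝ E]
    [FiniteDimensional ℝ E] {δ : ℝ} (hδ : 0 < δ) :
    ∃ F : Finset E, (∀ w ∈ F, ‖w‖ ≤ 1) ∧ (F.card : ℝ) ≤ (1 + 2 / δ) ^ Module.finrank ℝ E ∧
      ∀ z : E, ‖z‖ ≤ 1 → ∃ w ∈ F, ‖z - w‖ < δ := by
  classical
  let p : ℕ → Prop := fun N => ∃ F : Finset E, (∀ w ∈ F, ‖w‖ ≤ 1) ∧
    (∀ c ∈ F, ∀ d ∈ F, c ≠ d → δ ≤ ‖c - d‖) ∧ F.card = N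
  obtain ⟨b, hb⟩ := exists_nat_ge ((1 + 2 / δ) ^ Module.finrank ℝ E)
  have hpb : ∀ N, p N → N ≤ b := by
    rintro N ⟨F, h1, h2, rfl⟩
    exact_mod_cast (card_le_of_separated_closedBall F hδ h1 h2).trans hb
  have hp0 : p 0 := ⟨∅, by simp, by simp, rfl⟩
  -- A separated set of maximal cardinality is a net: a point of the ball at distance at least `δ`
  -- from all of it could be added.
  obtain ⟨F, h1, h2, h3⟩ : p (Nat.findGreatest p b) := Nat.findGreatest_spec (Nat.zero_le b) hp0
  refine ⟨F, h1, card_le_of_separated_closedBall F hδ h1 h2, fun z hz => ?_⟩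
  by_contra! hcon
  have hzF : z ∉ F := fun hzF => by simpa using (hcon z hzF).trans_lt' hδ
  have hq : p (Nat.findGreatest p b + 1) := by
    refine ⟨insert z F, ?_, ?_, by rw [Finset.card_insert_of_notMem hzF, h3]⟩
    · simpa [hz] using h1
    · intro c hc d hd hcd
      rcases Finset.mem_insert.1 hc with rfl | hc' <;> rcases Finset.mem_insert.1 hd with rfl | hd'
      · exact absurd rfl hcd
      · exact hcon d hd'
      · rw [norm_sub_rev]; exact hcon c hc'
      · exact h2 c hc' d hd' hcd
  have := Nat.le_findGreatest (hpb _ hq) hq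
  omega

end Covering

/-! ### Finite norming sets for polynomials -/

section Discretization

variable {X : Type*} [NormedAddCommGroup X] [NormedSpace ℂ X] [FiniteDimensional ℂ X]

theorem bddAbove_range_closedBall {f : X → ℝ} (hf : Continuous f) :
    BddAbove (Set.range fun z : Metric.closedBall (0 : X) 1 => f z) := by
  have := FiniteDimensional.proper ℂ X
  have h := (isCompact_closedBall (0 : X) 1).bddAbove_image hf.continuousOn
  rwa [Set.image_eq_range] at h

/-- A finite subset of the unit ball, of size polynomial in the degree to the power of the
dimension, on which polynomials attain at least half of their supremum. -/
theorem exists_norming_finset (X : Type*) [NormedAddCommGroup X] [NormedSpace ℂ X]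
    [FiniteDimensional ℂ X] (m : ℕ) :
    ∃ F : Finset X, (∀ w ∈ F, ‖w‖ ≤ 1) ∧
      (F.card : ℝ) ≤ (17 * ((max m 1 : ℕ) : ℝ)) ^ (2 * Module.finrank ℂ X) ∧
      ∀ P : X → ℂ, IsPolynomialOfDegreeLE m P →
        ∃ w ∈ F, ⨆ z : Metric.closedBall (0 : X) 1, ‖P z‖ ≤ 2 * ‖P w‖ := by
  let _ : NormedSpace ℝ X := NormedSpace.complexToReal
  have : FiniteDimensional ℝ X := FiniteDimensional.complexToReal X
  have hN : (1 : ℝ) ≤ ((max m 1 : ℕ) : ℝ) := by exact_mod_cast le_max_right _ _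
  set N : ℝ := ((max m 1 : ℕ) : ℝ) with hNdef
  -- With Lipschitz constant `4 * N * S`, this mesh makes the error at most `S / 2`, which is
  -- absorbed into the left side.
  have hδ : 0 < 1 / (8 * N) := by positivity
  obtain ⟨F, hF1, hF2, hF3⟩ := exists_finset_net (E := X) hδ
  have hne : F.Nonempty := by
    obtain ⟨w, hw, _⟩ := hF3 0 (by simp)
    exact ⟨w, hw⟩
  refine ⟨F, hF1, ?_, fun P hP => ?_⟩
  · rw [finrank_real_of_complex] at hF2
    refine hF2.trans ?_
    gcongr
    have : 2 / (1 / (8 * N)) = 16 * N := by field_simp; norm_num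
    rw [this]; linarith
  · obtain ⟨w₀, hw₀, hmax⟩ := F.exists_max_image (fun w => ‖P w‖) hne
    refine ⟨w₀, hw₀, ?_⟩
    set S := ⨆ z : Metric.closedBall (0 : X) 1, ‖P z‖ with hS
    have hbdd := bddAbove_range_closedBall hP.differentiable.continuous.norm
    have hM : ∀ z ∈ Metric.closedBall (0 : X) 1, ‖P z‖ ≤ S := fun z hz =>
      le_ciSup (f := fun z : Metric.closedBall (0 : X) 1 => ‖P z‖) hbdd ⟨z, hz⟩
    have hS0 : 0 ≤ S := (norm_nonneg _).trans (hM 0 (by simp))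
    have : Nonempty (Metric.closedBall (0 : X) 1) := ⟨⟨0, by simp⟩⟩
    have hle : S ≤ ‖P w₀‖ + S / 2 := by
      refine ciSup_le fun z => ?_
      have hz : ‖(z : X)‖ ≤ 1 := mem_closedBall_zero_iff.1 z.2
      obtain ⟨w, hw, hzw⟩ := hF3 z hz
      have h1 : ‖P z - P w‖ ≤ 4 * N * S * ‖(z : X) - w‖ := by
        refine hP.norm_sub_le hM (hF1 w hw) (hzw.trans_le ?_)
        rw [← hNdef]
        gcongr
        linarith
      have h2 : 4 * N * S * ‖(z : X) - w‖ ≤ 4 * N * S * (1 / (8 * N)) := by gcongr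
      have h3 : 4 * N * S * (1 / (8 * N)) = S / 2 := by field_simp; ring
      have h4 := norm_le_norm_add_norm_sub' (P z) (P w)
      have h5 := hmax w hw
      linarith
    linarith

end Discretization

/-! ### Subgaussian sums and their tails -/

section Subgaussian

variable {Ω : Type*} [MeasurableSpace Ω] {μ : Measure Ω}

theorem HasSubgaussianBound.mono {f : Ω → ℂ} {s t : ℝ} (h : HasSubgaussianBound f s μ)
    (hs : 0 ≤ s) (hst : s ≤ t) : HasSubgaussianBound f t μ := fun z =>
  (h z).trans (ENNReal.ofReal_le_ofReal (by gcongr))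

theorem IsSubgaussian.hasSubgaussianBound {f : Ω → ℂ} (hf : IsSubgaussian f μ) {s : ℝ}
    (hs : sg f μ < s) : HasSubgaussianBound f s μ := by
  obtain ⟨t, ⟨ht0, ht⟩, hts⟩ := exists_lt_of_csInf_lt
    (s := {s : ℝ | 0 ≤ s ∧ HasSubgaussianBound f s μ}) hf.2 hs
  exact ht.mono ht0 hts.le

/-- Independence factorizes the exponential moment, so squared subgaussian parameters add up. -/
theorem HasSubgaussianBound.sum_mul {K : ℕ} {γ : Fin K → Ω → ℂ} {s σ : ℝ}
    (hγ : ∀ i, HasSubgaussianBound (γ i) s μ) (hm : ∀ i, Measurable (γ i))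
    (hind : iIndepFun γ μ) (a : Fin K → ℂ) (hσ : s ^ 2 * ∑ i, ‖a i‖ ^ 2 ≤ σ ^ 2) :
    HasSubgaussianBound (fun ω => ∑ i, γ i ω * a i) σ μ := by
  intro z
  have hg : ∀ i, Measurable fun w : ℂ => ENNReal.ofReal (Real.exp (z * a i * w).re) := by
    intro i; fun_prop
  have hind' := hind.comp (fun i (w : ℂ) => ENNReal.ofReal (Real.exp (z * a i * w).re)) hg
  calc ∫⁻ ω, ENNReal.ofReal (Real.exp (z * ∑ i, γ i ω * a i).re) ∂μ
      = ∫⁻ ω, ∏ i, ENNReal.ofReal (Real.exp (z * a i * γ i ω).re) ∂μ := by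
        refine lintegral_congr fun ω => ?_
        rw [← ENNReal.ofReal_prod_of_nonneg fun i _ => (Real.exp_pos _).le, ← Real.exp_sum,
          ← Complex.re_sum, Finset.mul_sum]
        congr 4
        ext i
        ring
    _ = ∏ i, ∫⁻ ω, ENNReal.ofReal (Real.exp (z * a i * γ i ω).re) ∂μ :=
        lintegral_prod_eq_prod_lintegral_of_indepFun Finset.univ _ hind'
          fun i => (hg i).comp (hm i)
    _ ≤ ∏ i, ENNReal.ofReal (Real.exp (s ^ 2 * ‖z * a i‖ ^ 2 / 2)) :=
        Finset.prod_le_prod' fun i _ => hγ i (z * a i)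
    _ = ENNReal.ofReal (Real.exp (s ^ 2 * (∑ i, ‖a i‖ ^ 2) * ‖z‖ ^ 2 / 2)) := by
        rw [← ENNReal.ofReal_prod_of_nonneg fun i _ => (Real.exp_pos _).le, ← Real.exp_sum]
        congr 2
        rw [Finset.mul_sum, Finset.sum_mul, Finset.sum_div]
        refine Finset.sum_congr rfl fun i _ => ?_
        rw [norm_mul]
        ring
    _ ≤ ENNReal.ofReal (Real.exp (σ ^ 2 * ‖z‖ ^ 2 / 2)) := by gcongr

theorem HasSubgaussianBound.measure_re_ge_le {f : Ω → ℂ} {σ : ℝ}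
    (hf : HasSubgaussianBound f σ μ) (hm : Measurable f) (hσ : 0 < σ) {u : ℂ} (hu : ‖u‖ = 1)
    (t : ℝ) (ht : 0 ≤ t) :
    μ {ω | t ≤ (u * f ω).re} ≤ ENNReal.ofReal (Real.exp (-(t ^ 2 / (2 * σ ^ 2)))) := by
  -- The minimizer of the Chernoff exponent `σ² l² / 2 - l t`.
  set l : ℝ := t / σ ^ 2 with hl
  have hl0 : 0 ≤ l := by positivity
  have hmeas : Measurable fun ω => ENNReal.ofReal (Real.exp ((l : ℂ) * u * f ω).re) := by fun_prop
  have h1 : ENNReal.ofReal (Real.exp (l * t)) * μ {ω | t ≤ (u * f ω).re} ≤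
      ENNReal.ofReal (Real.exp (σ ^ 2 * l ^ 2 / 2)) := by
    calc ENNReal.ofReal (Real.exp (l * t)) * μ {ω | t ≤ (u * f ω).re}
        ≤ ENNReal.ofReal (Real.exp (l * t)) * μ {ω | ENNReal.ofReal (Real.exp (l * t)) ≤
            ENNReal.ofReal (Real.exp ((l : ℂ) * u * f ω).re)} := by
          gcongr with ω
          intro h
          rw [mul_assoc, Complex.re_ofReal_mul]
          gcongr
      _ ≤ ∫⁻ ω, ENNReal.ofReal (Real.exp ((l : ℂ) * u * f ω).re) ∂μ :=
          mul_meas_ge_le_lintegral hmeas _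
      _ ≤ _ := hf _
      _ = _ := by
          rw [norm_mul, hu, mul_one, Complex.norm_real, Real.norm_of_nonneg hl0]
  calc μ {ω | t ≤ (u * f ω).re}
      = ENNReal.ofReal (Real.exp (-(l * t))) *
        (ENNReal.ofReal (Real.exp (l * t)) * μ {ω | t ≤ (u * f ω).re}) := by
        rw [← mul_assoc, ← ENNReal.ofReal_mul (Real.exp_pos _).le, ← Real.exp_add]
        simp
    _ ≤ ENNReal.ofReal (Real.exp (-(l * t))) * ENNReal.ofReal (Real.exp (σ ^ 2 * l ^ 2 / 2)) := by
        gcongr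
    _ = _ := by
        rw [← ENNReal.ofReal_mul (Real.exp_pos _).le, ← Real.exp_add, hl]
        congr 2
        field_simp
        ring

/-- Otherwise `|Re w|` and `|Im w|` are both below `t / √2`, forcing `‖w‖ < t`. This reduces the
modulus to four real parts, at the price of a factor `2` in the exponent. -/
theorem exists_unit_re_mul_ge (w : ℂ) {t : ℝ} (hw : t ≤ ‖w‖) :
    ∃ u ∈ ({1, -1, Complex.I, -Complex.I} : Finset ℂ), t / √2 ≤ (u * w).re := by
  by_contra! h
  have h1 := h 1 (by simp)
  have h2 := h (-1) (by simp)
  have h3 := h Complex.I (by simp)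
  have h4 := h (-Complex.I) (by simp)
  simp at h1 h2 h3 h4
  have ht : 0 < t / √2 := by linarith
  have ht0 : 0 < t := by
    by_contra hcon
    exact absurd (div_nonpos_of_nonpos_of_nonneg (not_lt.1 hcon) (Real.sqrt_nonneg 2)) (not_le.2 ht)
  have e1 : w.re ^ 2 < (t / √2) ^ 2 := sq_lt_sq' (by linarith) h1
  have e2 : w.im ^ 2 < (t / √2) ^ 2 := sq_lt_sq' (by linarith) (by linarith)
  have e3 : (t / √2) ^ 2 = t ^ 2 / 2 := by rw [div_pow, Real.sq_sqrt (by norm_num)]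
  have e4 : ‖w‖ ^ 2 = w.re ^ 2 + w.im ^ 2 := by
    rw [← Complex.normSq_eq_norm_sq, Complex.normSq_apply]; ring
  have e5 : t ^ 2 ≤ ‖w‖ ^ 2 := by gcongr
  linarith

theorem HasSubgaussianBound.measure_norm_ge_le {f : Ω → ℂ} {σ : ℝ}
    (hf : HasSubgaussianBound f σ μ) (hm : Measurable f) (hσ : 0 < σ) {t : ℝ} (ht : 0 ≤ t) :
    μ {ω | t ≤ ‖f ω‖} ≤ 4 * ENNReal.ofReal (Real.exp (-(t ^ 2 / (4 * σ ^ 2)))) := by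
  have hsub : {ω | t ≤ ‖f ω‖} ⊆
      ⋃ u ∈ ({1, -1, Complex.I, -Complex.I} : Finset ℂ), {ω | t / √2 ≤ (u * f ω).re} := by
    intro ω hω
    obtain ⟨u, hu, h⟩ := exists_unit_re_mul_ge (f ω) hω
    exact Set.mem_biUnion hu h
  calc μ {ω | t ≤ ‖f ω‖}
      ≤ ∑ u ∈ ({1, -1, Complex.I, -Complex.I} : Finset ℂ), μ {ω | t / √2 ≤ (u * f ω).re} :=
        (measure_mono hsub).trans (measure_biUnion_finset_le _ _)
    _ ≤ ∑ u ∈ ({1, -1, Complex.I, -Complex.I} : Finset ℂ),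
          ENNReal.ofReal (Real.exp (-(t ^ 2 / (4 * σ ^ 2)))) := by
        refine Finset.sum_le_sum fun u hu => ?_
        have hu1 : ‖u‖ = 1 := by
          simp only [Finset.mem_insert, Finset.mem_singleton] at hu
          rcases hu with rfl | rfl | rfl | rfl <;> simp
        refine (hf.measure_re_ge_le hm hσ hu1 (t / √2) (by positivity)).trans_eq ?_
        rw [div_pow, Real.sq_sqrt (by norm_num)]
        congr 3
        field_simp
        norm_num
    _ ≤ _ := by
        rw [Finset.sum_const, nsmul_eq_mul]
        gcongr
        exact_mod_cast Finset.card_le_four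

end Subgaussian

/-! ### From tails to exponential moments and Orlicz norms of maxima -/

section Orlicz

variable {Ω : Type*} [MeasurableSpace Ω] {μ : Measure Ω}

/-- A constant bounding the exponential moment of a variable with tails `4 * exp (-c * k)`. -/
noncomputable def expMomentConst (c : ℝ) : ℝ :=
  4 * Real.exp (c / 2) * (1 - Real.exp (-(c / 2)))⁻¹

theorem two_le_expMomentConst {c : ℝ} (hc : 0 < c) : 2 ≤ expMomentConst c := by
  have h1 : 1 ≤ Real.exp (c / 2) := Real.one_le_exp (by positivity)
  have h2 : Real.exp (-(c / 2)) < 1 := by simpa using hc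
  have h3 : 1 ≤ (1 - Real.exp (-(c / 2)))⁻¹ :=
    (one_le_inv₀ (by linarith)).2 (by linarith [Real.exp_pos (-(c / 2))])
  unfold expMomentConst
  nlinarith

/-- Discrete layer-cake: the integrand is dominated by its term with `k = ⌊Y⌋`. Using half the decay
rate leaves a convergent geometric series. -/
theorem lintegral_exp_half_le {Y : Ω → ℝ} (hY : Measurable Y) (hY0 : ∀ ω, 0 ≤ Y ω) {c : ℝ}
    (hc : 0 < c)
    (h : ∀ k : ℕ, μ {ω | (k : ℝ) ≤ Y ω} ≤ 4 * ENNReal.ofReal (Real.exp (-(c * k)))) :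
    ∫⁻ ω, ENNReal.ofReal (Real.exp (c / 2 * Y ω)) ∂μ ≤ ENNReal.ofReal (expMomentConst c) := by
  have hms : ∀ k : ℕ, MeasurableSet {ω | (k : ℝ) ≤ Y ω} := fun k =>
    measurableSet_le measurable_const hY
  calc ∫⁻ ω, ENNReal.ofReal (Real.exp (c / 2 * Y ω)) ∂μ
      ≤ ∫⁻ ω, ∑' k : ℕ, {ω | (k : ℝ) ≤ Y ω}.indicator
          (fun _ => ENNReal.ofReal (Real.exp (c / 2 * (k + 1)))) ω ∂μ := by
        refine lintegral_mono fun ω => ?_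
        refine le_trans ?_ (ENNReal.le_tsum ⌊Y ω⌋₊)
        rw [Set.indicator_of_mem (by exact Nat.floor_le (hY0 ω))]
        gcongr
        exact (Nat.lt_floor_add_one _).le
    _ = ∑' k : ℕ, ENNReal.ofReal (Real.exp (c / 2 * (k + 1))) * μ {ω | (k : ℝ) ≤ Y ω} := by
        rw [lintegral_tsum fun k => (measurable_const.indicator (hms k)).aemeasurable]
        simp only [lintegral_indicator_const (hms _)]
    _ ≤ ∑' k : ℕ, ENNReal.ofReal (4 * Real.exp (c / 2) * Real.exp (-(c / 2)) ^ k) := by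
        refine ENNReal.tsum_le_tsum fun k => ?_
        calc ENNReal.ofReal (Real.exp (c / 2 * (k + 1))) * μ {ω | (k : ℝ) ≤ Y ω}
            ≤ ENNReal.ofReal (Real.exp (c / 2 * (k + 1))) *
              (4 * ENNReal.ofReal (Real.exp (-(c * k)))) := by gcongr; exact h k
          _ = _ := by
            rw [show (4 : ℝ≥0∞) = ENNReal.ofReal 4 by simp, ← ENNReal.ofReal_mul (by norm_num),
              ← ENNReal.ofReal_mul (Real.exp_pos _).le, ← Real.exp_nat_mul, mul_left_comm,
              ← Real.exp_add, mul_assoc, ← Real.exp_add]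
            congr 3
            ring
    _ = ENNReal.ofReal (expMomentConst c) := by
        have hlt : Real.exp (-(c / 2)) < 1 := by simpa using hc
        have hs := (hasSum_geometric_of_lt_one (Real.exp_pos (-(c / 2))).le hlt).mul_left
          (4 * Real.exp (c / 2))
        rw [← ENNReal.ofReal_tsum_of_nonneg (fun k => by positivity) hs.summable, hs.tsum_eq]
        rfl

theorem lintegral_rpow_le_rpow_lintegral [IsProbabilityMeasure μ] {G : Ω → ℝ≥0∞}
    (hG : Measurable G) {θ : ℝ} (hθ : 0 < θ) (hθ1 : θ ≤ 1) :
    ∫⁻ ω, G ω ^ θ ∂μ ≤ (∫⁻ ω, G ω ∂μ) ^ θ := by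
  have h := eLpNorm'_le_eLpNorm'_of_exponent_le hθ hθ1 μ hG.aestronglyMeasurable
  simp only [eLpNorm', enorm_eq_self, ENNReal.rpow_one, div_one] at h
  calc ∫⁻ ω, G ω ^ θ ∂μ = ((∫⁻ ω, G ω ^ θ ∂μ) ^ (1 / θ)) ^ θ := by
        rw [← ENNReal.rpow_mul, one_div_mul_cancel hθ.ne', ENNReal.rpow_one]
    _ ≤ _ := by gcongr

theorem orliczNorm_le_of_lintegral_exp_le {r : ℝ} {f : Ω → ℝ} [IsProbabilityMeasure μ] {ε : ℝ}
    (hε : 0 < ε) (h : ∫⁻ ω, ENNReal.ofReal (Real.exp ((|f ω| / ε) ^ r)) ∂μ ≤ 2) :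
    orliczNorm r f μ ≤ ENNReal.ofReal ε := by
  refine iInf₂_le (ε.toNNReal) ⟨Real.toNNReal_pos.2 hε, ?_⟩
  rw [Real.coe_toNNReal _ hε.le]
  have h1 : ∫⁻ ω, ENNReal.ofReal (expOrlicz r (|f ω| / ε)) ∂μ + 1 ≤ 1 + 1 := by
    calc ∫⁻ ω, ENNReal.ofReal (expOrlicz r (|f ω| / ε)) ∂μ + 1
        = ∫⁻ ω, (ENNReal.ofReal (expOrlicz r (|f ω| / ε)) + 1) ∂μ := by
          rw [lintegral_add_right _ measurable_const]; simp
      _ = ∫⁻ ω, ENNReal.ofReal (Real.exp ((|f ω| / ε) ^ r)) ∂μ := by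
          refine lintegral_congr fun ω => ?_
          have h0 : 0 ≤ expOrlicz r (|f ω| / ε) := by
            have : 1 ≤ Real.exp ((|f ω| / ε) ^ r) := Real.one_le_exp (by positivity)
            unfold expOrlicz
            linarith
          rw [← ENNReal.ofReal_one, ← ENNReal.ofReal_add h0 zero_le_one]
          simp [expOrlicz]
      _ ≤ 2 := h
      _ = 1 + 1 := by norm_num
  exact (ENNReal.add_le_add_iff_right ENNReal.one_ne_top).1 h1

/-- Bound the maximum of the exponentials by their sum, of integral at most `N * A`. Enlarging the
Orlicz scale by `θ ^ (-1 / r)` raises the exponentials to the power `θ ≤ 1`, and Jensen gives `(N *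
A) ^ θ`, which equals `2` for the chosen `θ`. -/
theorem orliczNorm_le_of_forall_exists_le [IsProbabilityMeasure μ] {ι : Type*} (F : Finset ι)
    {g : Ω → ℝ} {h : ι → Ω → ℝ} {r B A N : ℝ} (hr : 0 < r) (hB : 0 < B) (hA : 2 ≤ A) (hN : 1 ≤ N)
    (hFN : (F.card : ℝ) ≤ N) (hm : ∀ w ∈ F, Measurable (h w))
    (hg : ∀ ω, ∃ w ∈ F, |g ω| ≤ 2 * h w ω)
    (hint : ∀ w ∈ F, ∫⁻ ω, ENNReal.ofReal (Real.exp ((h w ω / B) ^ r)) ∂μ ≤ ENNReal.ofReal A) :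
    orliczNorm r g μ ≤ ENNReal.ofReal (2 * B * (Real.log (N * A) / Real.log 2) ^ (1 / r)) := by
  have hlog2 : 0 < Real.log 2 := Real.log_pos one_lt_two
  have hNA : 2 ≤ N * A := by nlinarith
  have hlog : Real.log 2 ≤ Real.log (N * A) := Real.log_le_log two_pos hNA
  have hlogpos : 0 < Real.log (N * A) := hlog2.trans_le hlog
  set θ : ℝ := Real.log 2 / Real.log (N * A) with hθ
  have hθ0 : 0 < θ := by positivity
  have hθ1 : θ ≤ 1 := (div_le_one hlogpos).2 hlog
  have hθinv : Real.log (N * A) / Real.log 2 = θ⁻¹ := (inv_div _ _).symm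
  rw [hθinv]
  refine orliczNorm_le_of_lintegral_exp_le (by positivity) ?_
  have hEm : ∀ w ∈ F, Measurable fun ω => ENNReal.ofReal (Real.exp ((h w ω / B) ^ r)) :=
    fun w hw => (Real.measurable_exp.comp (((hm w hw).div_const B).pow_const r)).ennreal_ofReal
  have hGm : Measurable fun ω => ∑ w ∈ F, ENNReal.ofReal (Real.exp ((h w ω / B) ^ r)) :=
    Finset.measurable_fun_sum _ hEm
  calc ∫⁻ ω, ENNReal.ofReal (Real.exp ((|g ω| / (2 * B * θ⁻¹ ^ (1 / r))) ^ r)) ∂μ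
      ≤ ∫⁻ ω, (∑ w ∈ F, ENNReal.ofReal (Real.exp ((h w ω / B) ^ r))) ^ θ ∂μ := by
        refine lintegral_mono fun ω => ?_
        obtain ⟨w, hw, hgw⟩ := hg ω
        have hw0 : 0 ≤ h w ω := by linarith [abs_nonneg (g ω)]
        have h1 : (|g ω| / (2 * B * θ⁻¹ ^ (1 / r))) ^ r ≤ (h w ω / B) ^ r * θ := by
          calc (|g ω| / (2 * B * θ⁻¹ ^ (1 / r))) ^ r
              ≤ (2 * h w ω / (2 * B * θ⁻¹ ^ (1 / r))) ^ r := by gcongr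
            _ = ((h w ω / B) / θ⁻¹ ^ (1 / r)) ^ r := by
                congr 1
                field_simp
            _ = (h w ω / B) ^ r * θ := by
                rw [Real.div_rpow (by positivity) (by positivity), ← Real.rpow_mul (by positivity),
                  one_div_mul_cancel hr.ne', Real.rpow_one, div_inv_eq_mul]
        calc ENNReal.ofReal (Real.exp ((|g ω| / (2 * B * θ⁻¹ ^ (1 / r))) ^ r))
            ≤ ENNReal.ofReal (Real.exp ((h w ω / B) ^ r * θ)) := by gcongr
          _ = ENNReal.ofReal (Real.exp ((h w ω / B) ^ r)) ^ θ := by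
              rw [Real.exp_mul, ENNReal.ofReal_rpow_of_pos (Real.exp_pos _)]
          _ ≤ _ := by
              gcongr
              exact Finset.single_le_sum
                (f := fun w => ENNReal.ofReal (Real.exp ((h w ω / B) ^ r))) (by simp) hw
    _ ≤ (∫⁻ ω, ∑ w ∈ F, ENNReal.ofReal (Real.exp ((h w ω / B) ^ r)) ∂μ) ^ θ :=
        lintegral_rpow_le_rpow_lintegral hGm hθ0 hθ1
    _ ≤ (ENNReal.ofReal (N * A)) ^ θ := by
        gcongr
        rw [lintegral_finsetSum' _ fun w hw => (hEm w hw).aemeasurable]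
        calc ∑ w ∈ F, ∫⁻ ω, ENNReal.ofReal (Real.exp ((h w ω / B) ^ r)) ∂μ
            ≤ ∑ w ∈ F, ENNReal.ofReal A := Finset.sum_le_sum hint
          _ = ENNReal.ofReal (F.card * A) := by
              rw [Finset.sum_const, nsmul_eq_mul, ENNReal.ofReal_mul (by positivity),
                ENNReal.ofReal_natCast]
          _ ≤ _ := by gcongr
    _ = 2 := by
        rw [ENNReal.ofReal_rpow_of_pos (by linarith), Real.rpow_def_of_pos (by linarith), hθ,
          mul_div_cancel₀ _ hlogpos.ne', Real.exp_log two_pos]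
        simp

end Orlicz

/-! ### Partial sums and tails of power series -/

section PowerSums

theorem sum_range_rpow_le {r : ℝ} (hr : 1 < r) (k : ℕ) :
    ∑ i ∈ Finset.range k, ((i : ℝ) + 1) ^ (-(1 - 1 / r)) ≤ r * (k : ℝ) ^ (1 / r) := by
  have hr0 : 0 < r := by linarith
  induction k with
  | zero => simp [hr0.ne']
  | succ k ih =>
    rw [Finset.sum_range_succ]
    have hx : (0 : ℝ) < (k : ℝ) + 1 := by positivity
    have hx1 : 1 / ((k : ℝ) + 1) ≤ 1 := (div_le_one hx).2 (by simp)
    -- Bernoulli's inequality for the concave power `1 / r` replaces comparison with an integral.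
    have h1 : (1 + -(1 / ((k : ℝ) + 1))) ^ (1 / r) ≤ 1 + 1 / r * -(1 / ((k : ℝ) + 1)) :=
      rpow_one_add_le_one_add_mul_self (by linarith) (by positivity)
        ((div_le_one hr0).2 hr.le)
    have h2 : (k : ℝ) ^ (1 / r) =
        ((k : ℝ) + 1) ^ (1 / r) * (1 + -(1 / ((k : ℝ) + 1))) ^ (1 / r) := by
      rw [← Real.mul_rpow hx.le (by linarith)]
      congr 1
      field_simp
      ring
    have h3 : ((k : ℝ) + 1) ^ (-(1 - 1 / r)) = ((k : ℝ) + 1) ^ (1 / r) * (1 / ((k : ℝ) + 1)) := by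
      rw [show -(1 - 1 / r) = 1 / r - 1 by ring, Real.rpow_sub hx, Real.rpow_one, mul_one_div]
    have h4 := mul_le_mul_of_nonneg_left h1
      (mul_nonneg hr0.le (Real.rpow_nonneg hx.le (1 / r)))
    have h5 : r * ((k : ℝ) + 1) ^ (1 / r) * (1 + 1 / r * -(1 / ((k : ℝ) + 1))) =
        r * ((k : ℝ) + 1) ^ (1 / r) - ((k : ℝ) + 1) ^ (1 / r) * (1 / ((k : ℝ) + 1)) := by
      field_simp
      ring
    push_cast
    rw [h3]
    rw [h2] at ih
    linarith

theorem one_add_mul_one_sub_le_rpow_neg {q y : ℝ} (hq : 0 ≤ q) (hy : 0 < y) :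
    1 + q * (1 - y) ≤ y ^ (-q) := by
  rw [Real.rpow_def_of_pos hy]
  have h1 := Real.add_one_le_exp (Real.log y * -q)
  have h2 := mul_le_mul_of_nonneg_left (Real.log_le_sub_one_of_pos hy) hq
  linarith

/-- Convexity of `y ↦ y ^ (-q)` at `1`, applied to `y = k / (k + 1)`; the right side telescopes. -/
theorem rpow_neg_succ_le {q : ℝ} (hq : 0 < q) {k : ℕ} (hk : 1 ≤ k) :
    ((k : ℝ) + 1) ^ (-(1 + q)) ≤ ((k : ℝ) ^ (-q) - ((k : ℝ) + 1) ^ (-q)) / q := by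
  have hk0 : (0 : ℝ) < k := by exact_mod_cast hk
  have hx : (0 : ℝ) < (k : ℝ) + 1 := by positivity
  have h1 := one_add_mul_one_sub_le_rpow_neg hq.le (y := k / ((k : ℝ) + 1)) (by positivity)
  rw [Real.div_rpow hk0.le hx.le, le_div_iff₀ (by positivity)] at h1
  have h2 : ((k : ℝ) + 1) ^ (-(1 + q)) = ((k : ℝ) + 1) ^ (-q) * (1 - k / ((k : ℝ) + 1)) := by
    rw [neg_add_rev, Real.rpow_add hx, Real.rpow_neg_one]
    congr 1
    field_simp
    ring
  rw [le_div_iff₀ hq, h2]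
  linarith

theorem sum_Ico_rpow_le {q : ℝ} (hq : 0 < q) {k : ℕ} (hk : 1 ≤ k) (K : ℕ) :
    ∑ i ∈ Finset.Ico k K, ((i : ℝ) + 1) ^ (-(1 + q)) ≤ (k : ℝ) ^ (-q) / q := by
  rcases le_total K k with h | h
  · rw [Finset.Ico_eq_empty_of_le h, Finset.sum_empty]
    positivity
  · have hs : ∑ i ∈ Finset.Ico k K, ((i : ℝ) + 1) ^ (-(1 + q)) ≤
        ((k : ℝ) ^ (-q) - (K : ℝ) ^ (-q)) / q := by
      induction K, h using Nat.le_induction with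
      | base => simp
      | succ K hK ih =>
        rw [Finset.sum_Ico_succ_top hK]
        push_cast
        refine (add_le_add ih (rpow_neg_succ_le hq (hk.trans hK))).trans_eq ?_
        ring
    refine hs.trans ?_
    gcongr
    simp only [sub_le_self_iff]
    positivity

end PowerSums

/-! ### Pointwise tails and the bound for the supremum -/

section Main

variable {Ω : Type*} [MeasurableSpace Ω] {μ : Measure Ω}

theorem norm_sort_le_of_weakNorm_le {K : ℕ} {r W : ℝ} (hr : 1 < r) (a : Fin K → ℂ)
    (ha : weakNorm (Real.conjExponent r) a ≤ W) (i : Fin K) :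
    ‖a (Tuple.sort (fun i => -‖a i‖) i)‖ ≤ W * ((i : ℝ) + 1) ^ (-(1 - 1 / r)) := by
  have h1 : ((i : ℝ) + 1) ^ (1 / Real.conjExponent r) * decRearr a i ≤ W :=
    (le_ciSup (f := fun k : Fin K => ((k : ℝ) + 1) ^ (1 / Real.conjExponent r) * decRearr a k)
      (Set.finite_range _).bddAbove i).trans ha
  have h2 : 1 / Real.conjExponent r = 1 - 1 / r := by
    have : r - 1 ≠ 0 := by linarith
    have : r ≠ 0 := by linarith
    unfold Real.conjExponent
    field_simp
  have hx : (0 : ℝ) < (i : ℝ) + 1 := by positivity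
  rw [h2] at h1
  rw [Real.rpow_neg hx.le, ← div_eq_mul_inv, le_div_iff₀ (by positivity), mul_comm]
  exact h1

theorem measure_norm_sum_ge_le_of_l2Norm {K : ℕ} {γ : Fin K → Ω → ℂ} {s W : ℝ}
    (hγ : ∀ i, HasSubgaussianBound (γ i) s μ) (hm : ∀ i, Measurable (γ i))
    (hind : iIndepFun γ μ) (hs : 0 < s) (hW : 0 < W) (a : Fin K → ℂ) (ha : l2Norm a ≤ W) (k : ℕ) :
    μ {ω | s * W * (k : ℝ) ^ ((1 : ℝ) / 2) ≤ ‖∑ i, γ i ω * a i‖} ≤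
      4 * ENNReal.ofReal (Real.exp (-(1 / 4 * k))) := by
  have hsum : ∑ i, ‖a i‖ ^ 2 ≤ W ^ 2 := (Real.sqrt_le_left hW.le).1 ha
  have hσ : s ^ 2 * ∑ i, ‖a i‖ ^ 2 ≤ (s * W) ^ 2 := by
    rw [mul_pow]
    gcongr
  have hf := HasSubgaussianBound.sum_mul hγ hm hind a hσ
  refine (hf.measure_norm_ge_le (by fun_prop) (by positivity) (by positivity)).trans_eq ?_
  congr 4
  rw [mul_pow, ← Real.sqrt_eq_rpow, Real.sq_sqrt (by positivity)]
  field_simp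

theorem measure_norm_sum_ge_le_of_weakNorm [IsProbabilityMeasure μ] {K : ℕ}
    {γ : Fin K → Ω → ℂ} {r s M W : ℝ} (hr : 2 < r)
    (hγ : ∀ i, HasSubgaussianBound (γ i) s μ) (hm : ∀ i, Measurable (γ i))
    (hind : iIndepFun γ μ) (hM : ∀ i, ∀ᵐ ω ∂μ, ‖γ i ω‖ ≤ M) (hM0 : 0 ≤ M) (hs : 0 < s) (hW : 0 < W)
    (a : Fin K → ℂ) (ha : weakNorm (Real.conjExponent r) a ≤ W) (k : ℕ) :
    μ {ω | (M * r + 1) * W * (k : ℝ) ^ (1 / r) ≤ ‖∑ i, γ i ω * a i‖} ≤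
      4 * ENNReal.ofReal (Real.exp (-((1 - 2 / r) / (4 * s ^ 2) * k))) := by
  have hr0 : 0 < r := by linarith
  have hq : 0 < 1 - 2 / r := by
    rw [sub_pos, div_lt_one hr0]
    exact hr
  -- For `k = 0` the claimed bound is `4`; the tail sum below needs `k ≥ 1`.
  rcases Nat.eq_zero_or_pos k with rfl | hk
  · refine prob_le_one.trans ?_
    simp only [CharP.cast_eq_zero, mul_zero, neg_zero, Real.exp_zero, ENNReal.ofReal_one, mul_one]
    norm_num
  have hk0 : (0 : ℝ) < k := by exact_mod_cast hk
  set e := Tuple.sort (fun i => -‖a i‖)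
  have hbound : ∀ i, ‖a (e i)‖ ≤ W * ((i : ℝ) + 1) ^ (-(1 - 1 / r)) := fun i =>
    norm_sort_le_of_weakNorm_le (by linarith) a ha i
  -- The rearranged sequence without its `k` largest entries (indices start at `0`). The head is
  -- controlled through `M`, and `b` through its `ℓ_2` norm.
  set b : Fin K → ℂ := fun i => if k ≤ (i : ℕ) then a (e i) else 0 with hb
  have hbsum : ∑ i, ‖b i‖ ^ 2 ≤ W ^ 2 * ((k : ℝ) ^ (-(1 - 2 / r)) / (1 - 2 / r)) := by
    calc ∑ i, ‖b i‖ ^ 2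
        ≤ ∑ i : Fin K, if k ≤ (i : ℕ) then W ^ 2 * ((i : ℝ) + 1) ^ (-(1 + (1 - 2 / r))) else 0 := by
          refine Finset.sum_le_sum fun i _ => ?_
          by_cases hi : k ≤ (i : ℕ)
          · simp only [hb, hi, if_true]
            calc ‖a (e i)‖ ^ 2 ≤ (W * ((i : ℝ) + 1) ^ (-(1 - 1 / r))) ^ 2 := by
                  gcongr
                  exact hbound i
              _ = _ := by
                  rw [mul_pow, ← Real.rpow_mul_natCast (by positivity)]
                  congr 2
                  push_cast
                  ring
          · simp [hb, hi]
      _ = ∑ i ∈ Finset.Ico k K, W ^ 2 * ((i : ℝ) + 1) ^ (-(1 + (1 - 2 / r))) := by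
          rw [Fin.sum_univ_eq_sum_range (fun i => if k ≤ i then
            W ^ 2 * ((i : ℝ) + 1) ^ (-(1 + (1 - 2 / r))) else 0), ← Finset.sum_filter]
          refine Finset.sum_congr ?_ fun _ _ => rfl
          ext i
          simp [and_comm]
      _ ≤ _ := by
          rw [← Finset.mul_sum]
          gcongr
          exact sum_Ico_rpow_le hq hk K
  have hhead : ∀ i : Fin K, ‖a (e i) - b i‖ ≤
      if (i : ℕ) < k then W * ((i : ℝ) + 1) ^ (-(1 - 1 / r)) else 0 := by
    intro i
    by_cases hi : k ≤ (i : ℕ)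
    · simp [hb, hi, not_lt.2 hi]
    · simpa [hb, hi, not_le.1 hi] using hbound i
  have hheadsum : ∑ i, ‖a (e i) - b i‖ ≤ W * (r * (k : ℝ) ^ (1 / r)) := by
    calc ∑ i, ‖a (e i) - b i‖
        ≤ ∑ i : Fin K, if (i : ℕ) < k then W * ((i : ℝ) + 1) ^ (-(1 - 1 / r)) else 0 :=
          Finset.sum_le_sum fun i _ => hhead i
      _ = ∑ i ∈ Finset.range K with i < k, W * ((i : ℝ) + 1) ^ (-(1 - 1 / r)) := by
          rw [Fin.sum_univ_eq_sum_range (fun i => if i < k then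
            W * ((i : ℝ) + 1) ^ (-(1 - 1 / r)) else 0), ← Finset.sum_filter]
      _ ≤ ∑ i ∈ Finset.range k, W * ((i : ℝ) + 1) ^ (-(1 - 1 / r)) := by
          refine Finset.sum_le_sum_of_subset_of_nonneg ?_ fun i _ _ => by positivity
          intro i
          simp
      _ ≤ _ := by
          rw [← Finset.mul_sum]
          gcongr
          exact sum_range_rpow_le (by linarith) k
  have hf := HasSubgaussianBound.sum_mul (γ := fun i => γ (e i)) (fun i => hγ (e i))
    (fun i => hm (e i)) (hind.precomp e.injective) b
    (σ := √(s ^ 2 * (W ^ 2 * ((k : ℝ) ^ (-(1 - 2 / r)) / (1 - 2 / r))))) (by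
      rw [Real.sq_sqrt (by positivity)]
      gcongr)
  have hsub : {ω | (M * r + 1) * W * (k : ℝ) ^ (1 / r) ≤ ‖∑ i, γ i ω * a i‖} ≤ᵐ[μ]
      {ω | W * (k : ℝ) ^ (1 / r) ≤ ‖∑ i, γ (e i) ω * b i‖} := by
    filter_upwards [ae_all_iff.2 hM] with ω hω h
    have h : (M * r + 1) * W * (k : ℝ) ^ (1 / r) ≤ ‖∑ i, γ i ω * a i‖ := h
    show W * (k : ℝ) ^ (1 / r) ≤ ‖∑ i, γ (e i) ω * b i‖
    have h1 : ∑ i, γ i ω * a i =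
        ∑ i, γ (e i) ω * b i + ∑ i, γ (e i) ω * (a (e i) - b i) := by
      rw [← Finset.sum_add_distrib, ← Equiv.sum_comp e]
      refine Finset.sum_congr rfl fun i _ => ?_
      ring
    have h2 : ‖∑ i, γ (e i) ω * (a (e i) - b i)‖ ≤ M * (W * (r * (k : ℝ) ^ (1 / r))) := by
      calc ‖∑ i, γ (e i) ω * (a (e i) - b i)‖ ≤ ∑ i, M * ‖a (e i) - b i‖ := by
            refine norm_sum_le_of_le _ fun i _ => ?_
            rw [norm_mul]
            gcongr
            exact hω (e i)
        _ ≤ _ := by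
            rw [← Finset.mul_sum]
            gcongr
    rw [h1] at h
    have h3 := norm_add_le (∑ i, γ (e i) ω * b i) (∑ i, γ (e i) ω * (a (e i) - b i))
    linarith
  refine (measure_mono_ae hsub).trans ((hf.measure_norm_ge_le (by fun_prop)
    (by positivity) (by positivity)).trans_eq ?_)
  congr 4
  rw [Real.sq_sqrt (by positivity), mul_pow, ← Real.rpow_mul_natCast hk0.le]
  -- The squared level `k ^ (2 / r)` divided by the variance factor `k ^ (-(1 - 2 / r))` is exactly
  -- `k`.
  have h1 : (k : ℝ) ^ (1 / r * (2 : ℕ)) = k * (k : ℝ) ^ (-(1 - 2 / r)) := by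
    rw [← Real.rpow_one_add' hk0.le (by
      rw [neg_sub, add_sub_cancel]
      positivity)]
    congr 1
    push_cast
    ring
  rw [h1]
  field_simp

/-- The constant relating tail decay at rate `c` to the Orlicz norm of a supremum. -/
noncomputable def supConst (r c : ℝ) : ℝ :=
  2 * (2 / c) ^ (1 / r) * ((6 + Real.log (expMomentConst c)) / Real.log 2) ^ (1 / r)

theorem supConst_pos {r c : ℝ} (hc : 0 < c) : 0 < supConst r c := by
  have h1 : 0 < Real.log 2 := Real.log_pos one_lt_two
  have h2 : 0 ≤ Real.log (expMomentConst c) :=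
    Real.log_nonneg (by linarith [two_le_expMomentConst hc])
  unfold supConst
  positivity

theorem log_card_mul_le {n : ℕ} (hn : 1 ≤ n) {N A : ℝ} (hN : 1 ≤ N) (hA : 2 ≤ A) :
    Real.log ((17 * N) ^ (2 * n) * A) ≤ (6 + Real.log A) * (n * (1 + Real.log N)) := by
  have h17 : Real.log 17 ≤ 3 := by
    rw [Real.log_le_iff_le_exp (by norm_num)]
    have h1 : (2.7 : ℝ) ^ 3 ≤ Real.exp 1 ^ 3 := by
      gcongr
      linarith [Real.exp_one_gt_d9]
    rw [← Real.exp_nat_mul] at h1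
    norm_num at h1 ⊢
    linarith
  have hlN : 0 ≤ Real.log N := Real.log_nonneg hN
  have hlA : 0 ≤ Real.log A := Real.log_nonneg (by linarith)
  have hn' : (1 : ℝ) ≤ n := by exact_mod_cast hn
  rw [Real.log_mul (by positivity) (by positivity), Real.log_pow,
    Real.log_mul (by norm_num) (by positivity)]
  push_cast
  have h1 : 1 ≤ (n : ℝ) * (1 + Real.log N) := by nlinarith
  have h2 := mul_le_mul_of_nonneg_left h1 hlA
  have h3 : (n : ℝ) * Real.log 17 ≤ n * 3 := by gcongr
  have h4 : 0 ≤ (n : ℝ) * Real.log N := by positivity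
  nlinarith

theorem orliczNorm_iSup_le [IsProbabilityMeasure μ] {X : Type*} [NormedAddCommGroup X]
    [NormedSpace ℂ X] [FiniteDimensional ℂ X] {m K : ℕ} {γ : Fin K → Ω → ℂ} {P : Fin K → X → ℂ} {r c B : ℝ}
    (hr : 0 < r) (hc : 0 < c) (hB : 0 < B) (hn : 1 ≤ Module.finrank ℂ X)
    (hm : ∀ i, Measurable (γ i)) (hP : ∀ i, IsPolynomialOfDegreeLE m (P i))
    (htail : ∀ w ∈ Metric.closedBall (0 : X) 1, ∀ k : ℕ,
      μ {ω | B * (k : ℝ) ^ (1 / r) ≤ ‖∑ i, γ i ω * P i w‖} ≤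
        4 * ENNReal.ofReal (Real.exp (-(c * k)))) :
    orliczNorm r (fun ω => ⨆ z : Metric.closedBall (0 : X) 1, ‖∑ i, γ i ω * P i z‖) μ ≤
      ENNReal.ofReal (supConst r c *
        ((Module.finrank ℂ X : ℝ) * (1 + Real.log ((max m 1 : ℕ) : ℝ))) ^ (1 / r) * B) := by
  obtain ⟨F, hF1, hFcard, hF⟩ := exists_norming_finset X m
  have hA := two_le_expMomentConst hc
  have hN : (1 : ℝ) ≤ ((max m 1 : ℕ) : ℝ) := by exact_mod_cast le_max_right _ _
  have hlog2 : 0 < Real.log 2 := Real.log_pos one_lt_two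
  have hlA : 0 ≤ Real.log (expMomentConst c) := Real.log_nonneg (by linarith)
  have hlN : 0 ≤ Real.log ((max m 1 : ℕ) : ℝ) := Real.log_nonneg hN
  have hNpow : (1 : ℝ) ≤ (17 * ((max m 1 : ℕ) : ℝ)) ^ (2 * Module.finrank ℂ X) :=
    one_le_pow₀ (by linarith)
  have hmeas : ∀ w : X, Measurable fun ω => ‖∑ i, γ i ω * P i w‖ := fun w => by fun_prop
  -- Rescaling `B` by `(2 / c) ^ (1 / r)` turns `(h / B) ^ r` into `c / 2` times itself, the rate at
  -- which the exponential moment is known.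
  have key := orliczNorm_le_of_forall_exists_le (μ := μ) F
    (g := fun ω => ⨆ z : Metric.closedBall (0 : X) 1, ‖∑ i, γ i ω * P i z‖)
    (h := fun w ω => ‖∑ i, γ i ω * P i w‖) (r := r) (B := B * (2 / c) ^ (1 / r))
    hr (by positivity) hA hNpow hFcard
    (fun w _ => hmeas w) (fun ω => ?_) (fun w hw => ?_)
  · refine key.trans (ENNReal.ofReal_le_ofReal ?_)
    have h1 := log_card_mul_le hn hN hA
    have h0 : 0 ≤ Real.log ((17 * ((max m 1 : ℕ) : ℝ)) ^ (2 * Module.finrank ℂ X) *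
        expMomentConst c) := Real.log_nonneg (by nlinarith)
    calc _ ≤ 2 * (B * (2 / c) ^ (1 / r)) * ((6 + Real.log (expMomentConst c)) *
          ((Module.finrank ℂ X : ℝ) * (1 + Real.log ((max m 1 : ℕ) : ℝ))) /
            Real.log 2) ^ (1 / r) := by gcongr
      _ = _ := by
          rw [mul_div_right_comm, Real.mul_rpow (by positivity) (by positivity), supConst]
          ring
  · obtain ⟨w, hw, h⟩ := hF _ (IsPolynomialOfDegreeLE.sum_mul Finset.univ hP fun i => γ i ω)
    refine ⟨w, hw, ?_⟩
    rwa [abs_of_nonneg (Real.iSup_nonneg fun _ => norm_nonneg _)]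
  · have h := lintegral_exp_half_le (μ := μ) (Y := fun ω => (‖∑ i, γ i ω * P i w‖ / B) ^ r)
      (((hmeas w).div_const B).pow_const r) (fun ω => by positivity) hc (fun k => by
        refine (measure_mono fun ω hω => ?_).trans
          (htail w (mem_closedBall_zero_iff.2 (hF1 w hw)) k)
        have hω : (k : ℝ) ≤ (‖∑ i, γ i ω * P i w‖ / B) ^ r := hω
        show B * (k : ℝ) ^ (1 / r) ≤ ‖∑ i, γ i ω * P i w‖
        rw [mul_comm, ← le_div_iff₀ hB]
        calc (k : ℝ) ^ (1 / r) ≤ ((‖∑ i, γ i ω * P i w‖ / B) ^ r) ^ (1 / r) := by gcongr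
          _ = _ := by
            rw [← Real.rpow_mul (by positivity), mul_one_div_cancel hr.ne', Real.rpow_one])
    refine le_of_eq_of_le (lintegral_congr fun ω => ?_) h
    congr 2
    rw [← div_div, Real.div_rpow (by positivity) (by positivity),
      ← Real.rpow_mul (by positivity), one_div_mul_cancel hr.ne', Real.rpow_one]
    field_simp

/-- Allows working with a strictly positive bound `W'` even when the supremum of the norms is `0`.
-/
theorem le_ofReal_mul_of_forall_gt {x : ℝ≥0∞} {D W : ℝ}
    (h : ∀ W' > W, x ≤ ENNReal.ofReal (D * W')) : x ≤ ENNReal.ofReal (D * W) := by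
  have hcont : Continuous fun W' : ℝ => ENNReal.ofReal (D * W') :=
    ENNReal.continuous_ofReal.comp (continuous_const_mul D)
  exact ge_of_tendsto ((hcont.tendsto W).mono_left nhdsWithin_le_nhds)
    (eventually_mem_nhdsWithin.mono h : ∀ᶠ W' in nhdsWithin W (Set.Ioi W), _)

theorem weakNorm_nonneg {K : ℕ} (p : ℝ) (a : Fin K → ℂ) : 0 ≤ weakNorm p a :=
  Real.iSup_nonneg fun k => mul_nonneg (by positivity) (norm_nonneg _)

/-- A crude bound, continuous in `a`: it shows that the supremum over the ball is finite without
proving continuity of the rearrangement. -/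
theorem weakNorm_le_sum {K : ℕ} (p : ℝ) (a : Fin K → ℂ) :
    weakNorm p a ≤ (∑ k : Fin K, ((k : ℝ) + 1) ^ (1 / p)) * ∑ i, ‖a i‖ := by
  refine Real.iSup_le (fun k => ?_) (by positivity)
  refine mul_le_mul ?_ ?_ (norm_nonneg _) (by positivity)
  · exact Finset.single_le_sum (f := fun k : Fin K => ((k : ℝ) + 1) ^ (1 / p))
      (fun _ _ => by positivity) (Finset.mem_univ k)
  · exact Finset.single_le_sum (f := fun i => ‖a i‖) (fun _ _ => norm_nonneg _)
      (Finset.mem_univ _)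

end Main

end KSZ

theorem mainTheorem4 :
    (∀ s : ℝ≥0, ∃ C : ℝ, 0 < C ∧
      ∀ (Ω : Type*) [MeasurableSpace Ω] (μ : Measure Ω) [IsProbabilityMeasure μ]
        (X : Type*) [NormedAddCommGroup X] [NormedSpace ℂ X] [FiniteDimensional ℂ X]
        (n m K : ℕ) (γ : Fin K → Ω → ℂ) (P : Fin K → X → ℂ),
        1 ≤ n → Module.finrank ℂ X = n →
        (∀ i, KSZ.IsSubgaussian (γ i) μ) → iIndepFun γ μ →
        (∀ i, KSZ.sg (γ i) μ ≤ s) →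
        (∀ i, KSZ.IsPolynomialOfDegreeLE m (P i)) →
        KSZ.orliczNorm 2
            (fun ω => ⨆ z : Metric.closedBall (0 : X) 1, ‖∑ i, γ i ω * P i z‖) μ
          ≤ ENNReal.ofReal
              (C * ((n : ℝ) * (1 + Real.log ((max m 1 : ℕ) : ℝ))) ^ ((1 : ℝ) / 2) *
                ⨆ z : Metric.closedBall (0 : X) 1, KSZ.l2Norm (fun i => P i z))) ∧
    (∀ r : ℝ, 2 < r → ∀ s M : ℝ≥0, ∃ C : ℝ, 0 < C ∧
      ∀ (Ω : Type*) [MeasurableSpace Ω] (μ : Measure Ω) [IsProbabilityMeasure μ]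
        (X : Type*) [NormedAddCommGroup X] [NormedSpace ℂ X] [FiniteDimensional ℂ X]
        (n m K : ℕ) (γ : Fin K → Ω → ℂ) (P : Fin K → X → ℂ),
        1 ≤ n → Module.finrank ℂ X = n →
        (∀ i, KSZ.IsSubgaussian (γ i) μ) → iIndepFun γ μ →
        (∀ i, KSZ.sg (γ i) μ ≤ s) →
        (∀ i, eLpNorm (γ i) ∞ μ ≤ M) →
        (∀ i, KSZ.IsPolynomialOfDegreeLE m (P i)) →
        KSZ.orliczNorm r
            (fun ω => ⨆ z : Metric.closedBall (0 : X) 1, ‖∑ i, γ i ω * P i z‖) μ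
          ≤ ENNReal.ofReal
              (C * ((n : ℝ) * (1 + Real.log ((max m 1 : ℕ) : ℝ))) ^ ((1 : ℝ) / r) *
                ⨆ z : Metric.closedBall (0 : X) 1,
                  KSZ.weakNorm (Real.conjExponent r) (fun i => P i z))) := by
  refine ⟨fun s => ?_, fun r hr s M => ?_⟩
  · refine ⟨KSZ.supConst 2 (1 / 4) * (s + 1), by
      have := KSZ.supConst_pos (r := 2) (c := 1 / 4) (by norm_num)
      positivity, ?_⟩
    intro Ω _ μ _ X _ _ _ n m K γ P hn hX hγ hind hsg hP
    subst hX
    refine KSZ.le_ofReal_mul_of_forall_gt fun W hW => ?_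
    have hcont : Continuous fun z : X => KSZ.l2Norm (fun i => P i z) := by
      have := fun i => (hP i).differentiable.continuous
      unfold KSZ.l2Norm
      fun_prop
    have hbdd := KSZ.bddAbove_range_closedBall hcont
    have hle : ∀ z ∈ Metric.closedBall (0 : X) 1, KSZ.l2Norm (fun i => P i z) ≤ W := fun z hz =>
      (le_ciSup hbdd ⟨z, hz⟩).trans hW.le
    have hW0 : 0 < W := (Real.iSup_nonneg fun _ => Real.sqrt_nonneg _).trans_lt hW
    -- Passing to `s + 1` avoids showing that the infimum `sg` is attained, and makes the parameter
    -- positive when `s = 0`.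
    have hs : (0 : ℝ) < s + 1 := by positivity
    have hsub : ∀ i, KSZ.HasSubgaussianBound (γ i) (s + 1) μ := fun i =>
      (hγ i).hasSubgaussianBound ((hsg i).trans_lt (lt_add_one _))
    have key := KSZ.orliczNorm_iSup_le (r := 2) (c := 1 / 4) (B := (s + 1) * W) two_pos
      (by norm_num) (by positivity) hn (fun i => (hγ i).1) hP fun w hw k =>
        KSZ.measure_norm_sum_ge_le_of_l2Norm hsub (fun i => (hγ i).1) hind hs hW0 _ (hle w hw) k
    refine key.trans_eq ?_
    congr 1
    ring
  · have hr0 : 0 < r := by linarith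
    have hs : (0 : ℝ) < s + 1 := by positivity
    have hc : 0 < (1 - 2 / r) / (4 * ((s : ℝ) + 1) ^ 2) := by
      have : 0 < 1 - 2 / r := by
        rw [sub_pos, div_lt_one hr0]
        exact hr
      positivity
    refine ⟨KSZ.supConst r ((1 - 2 / r) / (4 * ((s : ℝ) + 1) ^ 2)) * (M * r + 1), by
      have := KSZ.supConst_pos (r := r) hc
      positivity, ?_⟩
    intro Ω _ μ _ X _ _ _ n m K γ P hn hX hγ hind hsg hM hP
    subst hX
    refine KSZ.le_ofReal_mul_of_forall_gt fun W hW => ?_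
    have hcont : Continuous fun z : X =>
        (∑ k : Fin K, ((k : ℝ) + 1) ^ (1 / Real.conjExponent r)) * ∑ i, ‖P i z‖ := by
      have := fun i => (hP i).differentiable.continuous
      fun_prop
    have hbdd : BddAbove (Set.range fun z : Metric.closedBall (0 : X) 1 =>
        KSZ.weakNorm (Real.conjExponent r) (fun i => P i z)) :=
      (KSZ.bddAbove_range_closedBall hcont).range_mono _ fun z => KSZ.weakNorm_le_sum _ _
    have hle : ∀ z ∈ Metric.closedBall (0 : X) 1,
        KSZ.weakNorm (Real.conjExponent r) (fun i => P i z) ≤ W := fun z hz =>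
      (le_ciSup hbdd ⟨z, hz⟩).trans hW.le
    have hW0 : 0 < W := (Real.iSup_nonneg fun _ => KSZ.weakNorm_nonneg _ _).trans_lt hW
    have hsub : ∀ i, KSZ.HasSubgaussianBound (γ i) (s + 1) μ := fun i =>
      (hγ i).hasSubgaussianBound ((hsg i).trans_lt (lt_add_one _))
    have hMae : ∀ i, ∀ᵐ ω ∂μ, ‖γ i ω‖ ≤ M := fun i => by
      filter_upwards [ae_le_eLpNormEssSup (f := γ i) (μ := μ)] with ω hω
      have h := hω.trans (eLpNorm_exponent_top (f := γ i) (μ := μ) ▸ hM i)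
      rw [enorm_eq_nnnorm, ENNReal.coe_le_coe] at h
      exact_mod_cast h
    have key := KSZ.orliczNorm_iSup_le (r := r) (B := (M * r + 1) * W) hr0 hc
      (by positivity) hn (fun i => (hγ i).1) hP fun w hw k =>
        KSZ.measure_norm_sum_ge_le_of_weakNorm hr hsub (fun i => (hγ i).1) hind hMae M.2 hs hW0 _
          (hle w hw) k
    refine key.trans_eq ?_
    congr 1
    ring
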